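/- Let $G$ be a finite group. Let $\Gamma(G)$ be the comaximal subgroup graph of $G$: its vertices are the nontrivial proper subgroups of $G$, and two distinct vertices $H,K$ are adjacent if and only if $HK=G$. If the independence number satisfies $\alpha(\Gamma(G))\le 6$, then either $G$ is nilpotent, or $G$ is isomorphic to one of the five groups $$S_3,\quad D_5,\quad \mathbb{Z}_3\rtimes\mathbb{Z}_4,\quad \mathbb{Z}_3\rtimes\mathbb{Z}_8,\quad \mathbb{Z}_5\rtimes\mathbb{Z}_4,$$ where $D_5$ is the dihedral group of order $10$ and, in each of the three semidirect products, a generator of the second factor acts on the first factor by inversion. -/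

import Mathlib

open scoped Pointwise

/-- The comaximal subgroup graph of a group `G`: the vertices are the nontrivial proper subgroups
of `G`, and two distinct vertices `H`, `K` are adjacent iff `H K = G` (product of subsets). -/
def comaximalGraph (G : Type*) [Group G] :
    SimpleGraph {H : Subgroup G // H ≠ ⊥ ∧ H ≠ ⊤} where
  Adj H K := H ≠ K ∧ ((H : Subgroup G) : Set G) * ((K : Subgroup G) : Set G) = Set.univ
  symm := ⟨by
    rintro H K ⟨hne, h⟩
    refine ⟨hne.symm, ?_⟩
    have h' := congrArg (fun s : Set G => s⁻¹) h
    simpa [mul_inv_rev] using h'⟩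
  loopless := ⟨fun _ h => h.1 rfl⟩

/-- The action of the cyclic group `ZMod m` (`m` even) on the cyclic group `ZMod n`, both written
multiplicatively, in which the generator `1` of `ZMod m` acts by inversion. -/
def invAction (n m : ℕ) (hm : Even m) :
    Multiplicative (ZMod m) →* MulAut (Multiplicative (ZMod n)) :=
  AddMonoidHom.toMultiplicativeLeft
    (ZMod.lift m ⟨zmultiplesHom (Additive (MulAut (Multiplicative (ZMod n))))
        (Additive.ofMul (MulEquiv.inv (Multiplicative (ZMod n)))), by
      obtain ⟨k, rfl⟩ := hm
      have h2 : (MulEquiv.inv (Multiplicative (ZMod n)) :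
          MulAut (Multiplicative (ZMod n))) ^ 2 = 1 := by
        ext x
        simp [pow_two]
      apply Additive.toMul.injective
      simp only [zmultiplesHom_apply, toMul_zsmul, toMul_ofMul, toMul_zero]
      rw [zpow_natCast, ← two_mul, pow_mul, h2, one_pow]⟩)

theorem invAction_one (n m : ℕ) (hm : Even m) (x : Multiplicative (ZMod n)) :
    invAction n m hm (Multiplicative.ofAdd 1) x = x⁻¹ := by
  have h1 : (1 : ZMod m) = ((1 : ℤ) : ZMod m) := by simp
  rw [h1]
  simp only [invAction, AddMonoidHom.coe_toMultiplicativeLeft, Function.comp_apply, toAdd_ofAdd,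
    ZMod.lift_coe, zmultiplesHom_apply, one_smul, toMul_ofMul]
  rfl

/-- The semidirect product of `ZMod n` by `ZMod m` (`m` even), the generator of `ZMod m` acting
on `ZMod n` by inversion. -/
abbrev InvSemidirect (n m : ℕ) (hm : Even m) : Type :=
  Multiplicative (ZMod n) ⋊[invAction n m hm] Multiplicative (ZMod m)

/-! A finite non-nilpotent group has a maximal subgroup `M` that is not normal. Two conjugates of a
proper subgroup never have product `G`, so the nontrivial subgroups lying in conjugates of `M` form
an independent set. Since `M` alone has `M.index` conjugates, the bound 6 leaves little room:
`le_normalCore_of_lt` pushes every proper subgroup of `M` into the core, which makes `M` cyclic of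
order `p ^ k`.

Such an `M` is a self-normalizing abelian Sylow subgroup, so Burnside's transfer theorem gives a
normal complement `N`, with `3 ≤ |N| ≤ 6` and `|N| ≡ 1` mod `p`. Maximality of `M` makes `N` minimal
normal, which excludes order 6; a further count excludes 4. Hence `|N|` is 3 or 5, `p = 2`, and a
generator of `M` acts on `N` by inversion. Two last counts bound `k`. -/

namespace Comaximal

/-! ### Conjugates of a proper subgroup as independent sets. -/

section Conjugates

variable {G : Type*} [Group G]

/-- The conjugate `g H g⁻¹` of a subgroup. -/
def conjBy (g : G) (H : Subgroup G) : Subgroup G := H.map (MulAut.conj g).toMonoidHom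

theorem mem_conjBy {g x : G} {H : Subgroup G} : x ∈ conjBy g H ↔ g⁻¹ * x * g ∈ H := by
  constructor
  · rintro ⟨y, hy, rfl⟩
    simpa [mul_assoc] using hy
  · intro h
    exact ⟨_, h, by simp [mul_assoc]⟩

theorem conjBy_one (H : Subgroup G) : conjBy 1 H = H := by
  ext x; simp [mem_conjBy]

theorem conjBy_mul (a b : G) (H : Subgroup G) : conjBy (a * b) H = conjBy a (conjBy b H) := by
  ext x; simp [mem_conjBy, mul_assoc]

theorem conjBy_mono {H K : Subgroup G} (h : H ≤ K) (g : G) : conjBy g H ≤ conjBy g K :=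
  Subgroup.map_mono h

theorem card_conjBy (g : G) (H : Subgroup G) : Nat.card (conjBy g H) = Nat.card H :=
  Subgroup.card_map_of_injective (MulAut.conj g).injective

theorem conjBy_eq_self_iff {g : G} {H : Subgroup G} :
    conjBy g H = H ↔ g ∈ Subgroup.normalizer (H : Set G) := by
  rw [← inv_mem_iff, Subgroup.mem_normalizer_iff, SetLike.ext_iff]
  simp [mem_conjBy, iff_comm]

theorem conjBy_of_normal (g : G) (H : Subgroup G) [H.Normal] : conjBy g H = H := by
  rw [conjBy_eq_self_iff, Subgroup.normalizer_eq_top]; trivial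

theorem ncard_range_conjBy (H : Subgroup G) :
    (Set.range fun g => conjBy g H).ncard = (Subgroup.normalizer (H : Set G)).index := by
  have key : ∀ a b : G, conjBy a H = conjBy b H ↔ a⁻¹ * b ∈ Subgroup.normalizer (H : Set G) := by
    intro a b
    rw [← conjBy_eq_self_iff, conjBy_mul]
    constructor
    · intro h
      rw [← h, ← conjBy_mul, inv_mul_cancel, conjBy_one]
    · intro h
      rw [← conjBy_one (H := conjBy b H), ← mul_inv_cancel a, conjBy_mul, h]
  let f : G ⧸ Subgroup.normalizer (H : Set G) → Subgroup G :=
    Quotient.lift (fun g => conjBy g H) fun a b hab =>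
      (key a b).2 (QuotientGroup.leftRel_apply.1 hab)
  have hf : Function.Injective f := by
    rintro ⟨a⟩ ⟨b⟩ h
    exact QuotientGroup.eq.2 ((key a b).1 h)
  have hr : Set.range f = Set.range fun g => conjBy g H := by
    ext K
    constructor
    · rintro ⟨⟨a⟩, rfl⟩; exact ⟨a, rfl⟩
    · rintro ⟨a, rfl⟩; exact ⟨(a : G ⧸ _), rfl⟩
  rw [← hr, Subgroup.index, ← Nat.card_coe_set_eq, Nat.card_range_of_injective hf]

/-- Otherwise `G` is the single double coset `M a⁻¹b M`. As it contains 1, `a⁻¹b` lies in `M`, and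
the double coset is just `M`. -/
theorem conjBy_mul_conjBy_ne_univ {M : Subgroup G} (hM : M ≠ ⊤) (a b : G) :
    (conjBy a M : Set G) * (conjBy b M : Set G) ≠ Set.univ := by
  intro h
  have fact : ∀ g : G, ∃ u ∈ M, ∃ v ∈ M, u * (a⁻¹ * b) * v = g := by
    intro g
    have : a * g * b⁻¹ ∈ (conjBy a M : Set G) * (conjBy b M : Set G) := h ▸ Set.mem_univ _
    obtain ⟨u, hu, v, hv, e⟩ := this
    refine ⟨_, mem_conjBy.1 hu, _, mem_conjBy.1 hv, ?_⟩
    calc a⁻¹ * u * a * (a⁻¹ * b) * (b⁻¹ * v * b) = a⁻¹ * (u * v) * b := by group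
      _ = g := by simp only at e; rw [e]; group
  obtain ⟨u, hu, v, hv, e⟩ := fact 1
  have hab : a⁻¹ * b ∈ M := by
    have : a⁻¹ * b = u⁻¹ * v⁻¹ := by
      rw [← mul_right_inj u, ← mul_left_inj v, e]; group
    rw [this]
    exact M.mul_mem (M.inv_mem hu) (M.inv_mem hv)
  refine hM ((Subgroup.eq_top_iff' M).2 fun g => ?_)
  obtain ⟨u, hu, v, hv, rfl⟩ := fact g
  exact M.mul_mem (M.mul_mem hu hab) hv

theorem mul_ne_univ_of_le {H K H' K' : Subgroup G} (hH : H ≤ H') (hK : K ≤ K')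
    (h : (H' : Set G) * (K' : Set G) ≠ Set.univ) : (H : Set G) * (K : Set G) ≠ Set.univ := by
  intro e
  exact h (Set.univ_subset_iff.1 (e ▸ Set.mul_subset_mul hH hK))

theorem mul_ne_univ_of_card_lt [Finite G] {H K : Subgroup G}
    (h : Nat.card H * Nat.card K < Nat.card G) : (H : Set G) * (K : Set G) ≠ Set.univ := by
  intro e
  have := Set.natCard_mul_le (s := (H : Set G)) (t := (K : Set G))
  rw [e, Nat.card_coe_set_eq, Set.ncard_univ] at this
  exact absurd this (not_le.2 h)

theorem mul_ne_univ_of_le_of_le {H K L : Subgroup G} (hL : L ≠ ⊤) (hH : H ≤ L) (hK : K ≤ L) :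
    (H : Set G) * (K : Set G) ≠ Set.univ := by
  have := conjBy_mul_conjBy_ne_univ hL 1 1
  rw [conjBy_one] at this
  exact mul_ne_univ_of_le hH hK this

theorem ncard_le_indepNum [Finite G] (s : Set (Subgroup G)) (hs : ∀ H ∈ s, H ≠ ⊥ ∧ H ≠ ⊤)
    (hi : ∀ H ∈ s, ∀ K ∈ s, H ≠ K → (H : Set G) * (K : Set G) ≠ Set.univ) :
    s.ncard ≤ (comaximalGraph G).indepNum := by
  classical
  let t : Set {H : Subgroup G // H ≠ ⊥ ∧ H ≠ ⊤} := Subtype.val ⁻¹' s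
  have hts : Subtype.val '' t = s := by
    rw [Set.image_preimage_eq_iff]
    intro H hH
    exact ⟨⟨H, hs H hH⟩, rfl⟩
  have hfin : t.Finite := Set.toFinite t
  have hindep : (comaximalGraph G).IsIndepSet (hfin.toFinset : Set _) := by
    intro H hH K hK hne hadj
    rw [Set.Finite.coe_toFinset] at hH hK
    exact hi _ hH _ hK (fun h => hne (Subtype.ext h)) hadj.2
  have := hindep.card_le_indepNum
  rwa [← Set.ncard_eq_toFinset_card, ← Set.ncard_image_of_injective t Subtype.val_injective,
    hts] at this

/-- The nontrivial subgroups contained in some conjugate of `M`. -/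
def conjFamily (M : Subgroup G) : Set (Subgroup G) := {H | H ≠ ⊥ ∧ ∃ g, H ≤ conjBy g M}

theorem ncard_conjFamily_le [Finite G] {M : Subgroup G} (hM : M ≠ ⊤) :
    (conjFamily M).ncard ≤ (comaximalGraph G).indepNum := by
  refine ncard_le_indepNum _ ?_ ?_
  · rintro H ⟨hH, g, hg⟩
    refine ⟨hH, fun h => hM ?_⟩
    refine (Subgroup.eq_top_iff' M).2 fun x => ?_
    have := mem_conjBy.1 ((h ▸ hg) (Subgroup.mem_top (g * x * g⁻¹)))
    simpa [mul_assoc] using this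
  · rintro H ⟨-, a, ha⟩ K ⟨-, b, hb⟩ -
    exact mul_ne_univ_of_le ha hb (conjBy_mul_conjBy_ne_univ hM a b)

theorem conjBy_ne_bot {H : Subgroup G} (hH : H ≠ ⊥) (g : G) : conjBy g H ≠ ⊥ := by
  rw [Ne, conjBy, Subgroup.map_eq_bot_iff_of_injective _ (MulAut.conj g).injective]
  exact hH

theorem range_conjBy_subset {M H : Subgroup G} (hH : H ≠ ⊥) (h : H ≤ M) :
    (Set.range fun g => conjBy g H) ⊆ conjFamily M := by
  rintro _ ⟨g, rfl⟩
  exact ⟨conjBy_ne_bot hH g, g, conjBy_mono h g⟩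

theorem subset_conjFamily {M H : Subgroup G} (hH : H ≠ ⊥) (h : H ≤ M) : H ∈ conjFamily M :=
  ⟨hH, 1, by rwa [conjBy_one]⟩

theorem le_normalCore_iff {M H : Subgroup G} : H ≤ M.normalCore ↔ ∀ g, conjBy g H ≤ M := by
  constructor
  · intro h g x hx
    have := h (mem_conjBy.1 hx) g
    simpa [mul_assoc] using this
  · intro h x hx g
    exact h g (mem_conjBy.2 (by simpa [mul_assoc] using hx))


/-! ### Non-normal maximal subgroups and their proper subgroups. -/

theorem normalizer_eq_self_of_isCoatom {M : Subgroup G} (hM : IsCoatom M) (hn : ¬ M.Normal) :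
    Subgroup.normalizer (M : Set G) = M := by
  rcases hM.le_iff.1 (Subgroup.le_normalizer (H := M)) with h | h
  · exact absurd (Subgroup.normalizer_eq_top_iff.1 h) hn
  · exact h

theorem ncard_range_conjBy_of_isCoatom {M : Subgroup G} (hM : IsCoatom M) (hn : ¬ M.Normal) :
    (Set.range fun g => conjBy g M).ncard = M.index := by
  rw [ncard_range_conjBy, normalizer_eq_self_of_isCoatom hM hn]

theorem three_le_index [Finite G] {M : Subgroup G} (hn : ¬ M.Normal) : 3 ≤ M.index := by
  have h0 : M.index ≠ 0 := Subgroup.index_ne_zero_of_finite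
  have h1 : M.index ≠ 1 := fun h => hn (by rw [Subgroup.index_eq_one.1 h]; infer_instance)
  have h2 : M.index ≠ 2 := fun h => hn (Subgroup.normal_of_index_eq_two h)
  omega

/-- The conjugates of a maximal non-normal subgroup together with some of the proper nontrivial
subgroups of its conjugates. -/
theorem index_add_ncard_le [Finite G] {M : Subgroup G} (hM : IsCoatom M) (hn : ¬ M.Normal)
    (s : Set (Subgroup G)) (hs : s ⊆ conjFamily M) (hc : ∀ H ∈ s, Nat.card H < Nat.card M) :
    M.index + s.ncard ≤ (comaximalGraph G).indepNum := by
  have hbot : M ≠ ⊥ := fun h => hn (h ▸ inferInstance)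
  rw [← ncard_range_conjBy_of_isCoatom hM hn, ← Set.ncard_union_eq]
  · exact (Set.ncard_le_ncard (Set.union_subset (range_conjBy_subset hbot le_rfl) hs)).trans
      (ncard_conjFamily_le hM.1)
  -- Every conjugate of `M` has the order of `M`, whereas members of `s` are smaller.
  · rw [Set.disjoint_left]
    rintro _ ⟨g, rfl⟩ h
    have := hc _ h
    rw [card_conjBy] at this
    exact lt_irrefl _ this

/-- Write `g = m * b` with `m` in `M` and `b` normalizing `H`: only `m` moves `H`, and it keeps it
inside `M`. -/
theorem conjBy_le_of_normalizer_sup {M H : Subgroup G} (h : H ≤ M)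
    [hB : (Subgroup.normalizer (H : Set G)).Normal]
    (hs : M ⊔ Subgroup.normalizer (H : Set G) = ⊤) (g : G) : conjBy g H ≤ M := by
  have hg : g ∈ M ⊔ Subgroup.normalizer (H : Set G) := hs ▸ Subgroup.mem_top g
  obtain ⟨m, hm, b, hb, rfl⟩ := Subgroup.mem_sup_of_normal_right.1 hg
  rw [conjBy_mul, conjBy_eq_self_iff.2 hb]
  intro x hx
  have := M.mul_mem (M.mul_mem hm (h (mem_conjBy.1 hx))) (M.inv_mem hm)
  simpa [mul_assoc] using this

/-- If `H` escapes the core, the conjugates of `M` and of `H` together number at most 6. Normalizer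
index 1 or 2 would put `H` in the core, so both indices are 3; counting the core as well forces it
to be trivial, so `G` is too small to contain such an `H`. -/
theorem le_normalCore_of_lt [Finite G] (hα : (comaximalGraph G).indepNum ≤ 6) {M : Subgroup G}
    (hM : IsCoatom M) (hn : ¬ M.Normal) {H : Subgroup G} (hH : H < M) : H ≤ M.normalCore := by
  by_contra hcon
  have hlt : ∀ K : Subgroup G, K < M → Nat.card K < Nat.card M := fun K hK =>
    (Set.ncard_lt_ncard hK)
  have hbot : H ≠ ⊥ := fun h => hcon (h ▸ bot_le)
  have h3 := three_le_index hn
  set B := Subgroup.normalizer (H : Set G) with hB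
  have hd : M.index + B.index ≤ 6 := by
    rw [hB, ← ncard_range_conjBy]
    refine (index_add_ncard_le hM hn _ (range_conjBy_subset hbot hH.le) ?_).trans hα
    rintro _ ⟨g, rfl⟩
    rw [card_conjBy]
    exact hlt H hH
  have hB1 : B.index ≠ 1 := by
    intro h
    have : H.Normal := Subgroup.normalizer_eq_top_iff.1 (Subgroup.index_eq_one.1 h)
    exact hcon (Subgroup.normal_le_normalCore.2 hH.le)
  have hB0 : B.index ≠ 0 := Subgroup.index_ne_zero_of_finite
  by_cases hB2 : B.index = 2
  · have hBn : B.Normal := Subgroup.normal_of_index_eq_two hB2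
    have hsup : M ⊔ B = ⊤ := by
      rcases hM.le_iff.1 (le_sup_left : M ≤ M ⊔ B) with h | h
      · exact h
      · have hBM : B ≤ M := h ▸ le_sup_right
        have hd := Subgroup.index_dvd_of_le hBM
        rw [hB2] at hd
        have := Nat.le_of_dvd two_pos hd
        omega
    exact hcon (le_normalCore_iff.2 (conjBy_le_of_normalizer_sup hH.le hsup))
  have hMi : M.index = 3 := by omega
  have hBi : B.index = 3 := by omega
  have hcore : M.normalCore = ⊥ := by
    by_contra hc
    have hCM : M.normalCore < M :=
      lt_of_le_of_ne M.normalCore_le fun h => hn (h ▸ inferInstance)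
    have := (index_add_ncard_le hM hn (insert M.normalCore (Set.range fun g => conjBy g H))
      (Set.insert_subset (subset_conjFamily hc hCM.le) (range_conjBy_subset hbot hH.le))
      (by
        rintro _ (rfl | ⟨g, rfl⟩)
        · exact hlt _ hCM
        · rw [card_conjBy]; exact hlt H hH)).trans hα
    rw [Set.ncard_insert_of_notMem, ncard_range_conjBy, ← hB, hBi, hMi] at this
    · omega
    · rintro ⟨g, hg⟩
      apply hcon
      have hg : conjBy g H = M.normalCore := hg
      have : H = conjBy g⁻¹ (conjBy g H) := by rw [← conjBy_mul, inv_mul_cancel, conjBy_one]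
      rw [this, hg, conjBy_of_normal]
  -- The action on the three cosets of `M` has the trivial core as kernel, so `G` embeds in a
  -- symmetric group of order 6.
  have hdvd : Nat.card G ∣ 6 := by
    have h1 : Nat.card (MulAction.toPermHom G (G ⧸ M)).range ∣ Nat.card (Equiv.Perm (G ⧸ M)) :=
      Subgroup.card_subgroup_dvd_card _
    rw [← Subgroup.index_ker, ← Subgroup.normalCore_eq_ker, hcore, Subgroup.index_bot,
      Nat.card_perm, ← Subgroup.index, hMi] at h1
    exact h1
  have h4 := M.card_mul_index
  rw [hMi] at h4
  have h5 : Nat.card M ≤ 2 := by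
    have := Nat.le_of_dvd (by norm_num) hdvd
    omega
  have h6 := hlt H hH
  have h7 : Nat.card H ≠ 1 := fun h => hbot (Subgroup.card_eq_one.1 h)
  have h8 : 0 < Nat.card H := Nat.card_pos
  omega

/-- Any element of `M` outside the core generates `M`. For such an `x`, `x ^ q` lies in the core for
each prime `q` dividing its order; two distinct primes would put `x` there by Bézout. -/
theorem exists_generator_of_le_normalCore [Finite G] {M : Subgroup G} (hn : ¬ M.Normal)
    (h : ∀ H < M, H ≤ M.normalCore) :
    ∃ x, Subgroup.zpowers x = M ∧ ∃ p k, p.Prime ∧ 0 < k ∧ Nat.card M = p ^ k := by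
  have hne : M.normalCore ≠ M := fun h => hn (h ▸ inferInstance)
  obtain ⟨x, hxM, hx⟩ := SetLike.exists_of_lt (lt_of_le_of_ne M.normalCore_le hne)
  have hz : ∀ y ∈ M, y ∉ M.normalCore → Subgroup.zpowers y = M := by
    intro y hy hyc
    by_contra hcon
    exact hyc (h _ (lt_of_le_of_ne ((Subgroup.zpowers_le).2 hy) hcon)
      (Subgroup.mem_zpowers y))
  refine ⟨x, hz x hxM hx, ?_⟩
  have hcard : Nat.card M = orderOf x := by rw [← hz x hxM hx, Nat.card_zpowers]
  have hx1 : orderOf x ≠ 1 := fun h => hx (by rw [orderOf_eq_one_iff.1 h]; exact one_mem _)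
  have hx0 : 0 < orderOf x := orderOf_pos x
  have hpow : ∀ d, d ∣ orderOf x → d ≠ 1 → x ^ d ∈ M.normalCore := by
    intro d hd hd1
    by_contra hcon
    have h1 := hz _ (M.pow_mem hxM d) hcon
    have h2 : orderOf (x ^ d) = orderOf x := by
      rw [← Nat.card_zpowers, h1, hcard]
    rw [orderOf_pow, Nat.gcd_eq_right hd] at h2
    obtain ⟨c, hc⟩ := hd
    have hd0 : 0 < d := Nat.pos_of_ne_zero (by rintro rfl; omega)
    have hc0 : 0 < c := Nat.pos_of_ne_zero (by rintro rfl; omega)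
    rw [hc, Nat.mul_div_cancel_left _ hd0] at h2
    have : 1 * c = d * c := by omega
    exact hd1 (Nat.eq_of_mul_eq_mul_right hc0 this).symm
  obtain ⟨p, hp, hpd⟩ := Nat.exists_prime_and_dvd hx1
  have : ∀ q, q.Prime → q ∣ orderOf x → q = p := by
    intro q hq hqd
    by_contra hne
    have h1 := hpow q hqd hq.ne_one
    have h2 := hpow p hpd hp.ne_one
    have hco : IsCoprime (q : ℤ) (p : ℤ) := Nat.isCoprime_iff_coprime.2
      ((Nat.coprime_primes hq hp).2 hne)
    obtain ⟨a, b, hab⟩ := hco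
    apply hx
    have : x = (x ^ q) ^ a * (x ^ p) ^ b := by
      rw [← zpow_natCast, ← zpow_natCast, ← zpow_mul, ← zpow_mul, ← zpow_add, mul_comm,
        mul_comm (p : ℤ), hab, zpow_one]
    rw [this]
    exact mul_mem (zpow_mem h1 a) (zpow_mem h2 b)
  have hk := Nat.eq_prime_pow_of_unique_prime_dvd hx0.ne' (fun {d} hd hdd => this d hd hdd)
  refine ⟨p, _, hp, Nat.pos_of_ne_zero ?_, hcard.trans hk⟩
  intro h0
  rw [h0] at hk
  exact hx1 hk


end Conjugates

/-! ### Recognizing the semidirect products. -/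

/-- A group of order `n m` generated by `y` of order `n` and `x` of order `m`, with `x` inverting
`y`, is the corresponding semidirect product. -/
theorem nonempty_mulEquiv_invSemidirect {G : Type*} [Group G] [Finite G] {n m : ℕ} (hm : Even m)
    (hn0 : n ≠ 0) (hm0 : m ≠ 0) (hco : n.Coprime m) {x y : G} (hy : orderOf y = n)
    (hx : orderOf x = m) (hxy : x * y * x⁻¹ = y⁻¹) (hcard : Nat.card G = n * m) :
    Nonempty (G ≃* InvSemidirect n m hm) := by
  have : NeZero n := ⟨hn0⟩
  have : NeZero m := ⟨hm0⟩
  let fy : Multiplicative (ZMod n) →* G := AddMonoidHom.toMultiplicativeLeft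
    (ZMod.lift n ⟨zmultiplesHom (Additive G) (Additive.ofMul y), by
      apply Additive.toMul.injective
      simp [← hy, pow_orderOf_eq_one]⟩)
  let fx : Multiplicative (ZMod m) →* G := AddMonoidHom.toMultiplicativeLeft
    (ZMod.lift m ⟨zmultiplesHom (Additive G) (Additive.ofMul x), by
      apply Additive.toMul.injective
      simp [← hx, pow_orderOf_eq_one]⟩)
  have hfy : ∀ k : ℤ, fy (Multiplicative.ofAdd (k : ZMod n)) = y ^ k := by
    intro k; simp [fy]
  have hfx : ∀ k : ℤ, fx (Multiplicative.ofAdd (k : ZMod m)) = x ^ k := by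
    intro k; simp [fx]
  have hfx1 : fx (Multiplicative.ofAdd 1) = x := by simpa using hfx 1
  have hfy1 : fy (Multiplicative.ofAdd 1) = y := by simpa using hfy 1
  have hconj : ∀ u, fy u⁻¹ = x * fy u * x⁻¹ := by
    intro u
    obtain ⟨k, hk⟩ := ZMod.intCast_surjective u.toAdd
    have hu : u = Multiplicative.ofAdd (k : ZMod n) := by rw [hk]; rfl
    rw [map_inv, hu, hfy, ← conj_zpow, hxy, inv_zpow]
  have hcompat : ∀ g, fy.comp ((invAction n m hm) g).toMonoidHom =
      (MulAut.conj (fx g)).toMonoidHom.comp fy := by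
    intro g
    obtain ⟨k, hk⟩ := ZMod.natCast_zmod_surjective g.toAdd
    have hg : g = (Multiplicative.ofAdd (1 : ZMod m)) ^ k := by
      rw [← ofAdd_nsmul, nsmul_one, hk]; rfl
    rw [hg]
    clear hg hk
    induction k with
    | zero => exact MonoidHom.ext fun u => by simp
    | succ k ih =>
      refine MonoidHom.ext fun u => ?_
      have h1 := fun u => DFunLike.congr_fun ih u
      simp only [MonoidHom.comp_apply, MulEquiv.coe_toMonoidHom, MulAut.conj_apply] at h1 ⊢
      rw [pow_succ', map_mul, map_mul, hfx1, MulAut.mul_apply, invAction_one, hconj, h1]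
      group
  let F : InvSemidirect n m hm →* G := SemidirectProduct.lift fy fx hcompat
  have hFx : x ∈ F.range := ⟨SemidirectProduct.inr (Multiplicative.ofAdd 1), by
    simp only [F, SemidirectProduct.lift_inr, hfx1]⟩
  have hFy : y ∈ F.range := ⟨SemidirectProduct.inl (Multiplicative.ofAdd 1), by
    simp only [F, SemidirectProduct.lift_inl, hfy1]⟩
  -- The order of the range is divisible by the coprime numbers `n` and `m`.
  have hsurj : Function.Surjective F := by
    rw [← MonoidHom.range_eq_top]
    apply Subgroup.eq_top_of_le_card
    rw [hcard]
    refine Nat.le_of_dvd Nat.card_pos (hco.mul_dvd_of_dvd_of_dvd ?_ ?_)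
    · exact hy.symm.dvd.trans (Subgroup.orderOf_dvd_natCard _ hFy)
    · exact hx.symm.dvd.trans (Subgroup.orderOf_dvd_natCard _ hFx)
  have hcard' : Nat.card (InvSemidirect n m hm) = Nat.card G := by
    rw [SemidirectProduct.card, hcard]
    simp [Nat.card_eq_fintype_card]
  have : Finite (InvSemidirect n m hm) := Nat.finite_of_card_ne_zero (by
    rw [hcard', hcard]; exact mul_ne_zero hn0 hm0)
  exact ⟨(MulEquiv.ofBijective F
    ((Nat.bijective_iff_surjective_and_card F).2 ⟨hsurj, hcard'⟩)).symm⟩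

theorem nonempty_perm_three_mulEquiv :
    Nonempty (Equiv.Perm (Fin 3) ≃* InvSemidirect 3 2 (by decide)) := by
  refine nonempty_mulEquiv_invSemidirect (x := Equiv.swap 0 1) (y := finRotate 3) _ (by norm_num)
    (by norm_num) (by norm_num) ?_ ?_ (by decide) ?_
  · exact orderOf_eq_prime (by decide) (by decide)
  · exact orderOf_eq_prime (by decide) (by decide)
  · rw [Nat.card_perm]; simp [Nat.factorial]

theorem nonempty_dihedralGroup_mulEquiv {n : ℕ} (hn : Odd n) :
    Nonempty (DihedralGroup n ≃* InvSemidirect n 2 (by decide)) := by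
  have : NeZero n := ⟨hn.pos.ne'⟩
  refine nonempty_mulEquiv_invSemidirect (x := DihedralGroup.sr 0) (y := DihedralGroup.r 1) _
    hn.pos.ne' (by norm_num) hn.coprime_two_right ?_ ?_ ?_ ?_
  · exact DihedralGroup.orderOf_r_one
  · exact DihedralGroup.orderOf_sr 0
  · simp
  · rw [DihedralGroup.nat_card, mul_comm]

/-- A proper cyclic subgroup bounds the independence number below by the number of nontrivial
subgroups it has. -/
theorem card_le_indepNum_of_zpowers_ne_top {G : Type*} [Group G] [Finite G] {w : G}
    (hw : Subgroup.zpowers w ≠ ⊤) (T : Finset ℕ)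
    (hT : ∀ d ∈ T, d ∣ orderOf w ∧ d < orderOf w) : T.card ≤ (comaximalGraph G).indepNum := by
  have hle : ∀ d, Subgroup.zpowers (w ^ d) ≤ Subgroup.zpowers w := fun d =>
    Subgroup.zpowers_le.2 (Subgroup.npow_mem_zpowers w d)
  have hw0 := orderOf_pos w
  have hcard : ∀ d ∈ T, d * Nat.card (Subgroup.zpowers (w ^ d)) = orderOf w := by
    intro d hd
    rw [Nat.card_zpowers, orderOf_pow, Nat.gcd_eq_right (hT d hd).1,
      Nat.mul_div_cancel' (hT d hd).1]
  have hinj : Set.InjOn (fun d => Subgroup.zpowers (w ^ d)) T := by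
    intro d hd e he hde
    have h1 := hcard d hd
    have h2 := hcard e he
    simp only at hde
    rw [← hde] at h2
    exact Nat.eq_of_mul_eq_mul_right Nat.card_pos (h1.trans h2.symm)
  have := ncard_le_indepNum ((fun d => Subgroup.zpowers (w ^ d)) '' (T : Set ℕ)) ?_ ?_
  · rwa [hinj.ncard_image, Set.ncard_coe_finset] at this
  · rintro _ ⟨d, hd, rfl⟩
    refine ⟨fun h => ?_, fun h => hw (top_le_iff.1 (h ▸ hle d))⟩
    have h1 := hcard d hd
    simp only at h
    rw [h, Subgroup.card_bot] at h1
    have := (hT d hd).2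
    omega
  · rintro _ ⟨d, -, rfl⟩ _ ⟨e, -, rfl⟩ -
    exact mul_ne_univ_of_le_of_le hw (hle d) (hle e)


/-! ### The normal complement and its order. -/

variable {G : Type*} [Group G]

/-- A Sylow subgroup above `M` is `M` or `G`; in the latter case `G` is nilpotent and `M` would be
normal. -/
theorem exists_sylow_coe_eq [Finite G] {M : Subgroup G} (hM : IsCoatom M) (hn : ¬ M.Normal)
    {p : ℕ} [Fact p.Prime] (hp : IsPGroup p M) : ∃ P : Sylow p G, (P : Subgroup G) = M := by
  obtain ⟨P, hP⟩ := hp.exists_le_sylow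
  refine ⟨P, (hM.le_iff.1 hP).resolve_left fun h => hn ?_⟩
  have hG : IsPGroup p G := by
    have h1 := P.isPGroup'
    rw [h] at h1
    exact h1.of_equiv Subgroup.topEquiv
  have hnil := hG.isNilpotent
  exact (Group.isNilpotent_of_finite_tfae.out 0 2 rfl rfl).1 hnil M hM

/-- A non-normal maximal subgroup that is an abelian `p`-group has a normal complement, whose
order is congruent to `1` modulo `p`. -/
theorem exists_normal_isComplement' [Finite G] {M : Subgroup G} (hM : IsCoatom M)
    (hn : ¬ M.Normal) {p : ℕ} [Fact p.Prime] (hp : IsPGroup p M)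
    (hc : M ≤ Subgroup.centralizer (M : Set G)) :
    M.index ≡ 1 [MOD p] ∧ ∃ N : Subgroup G, N.Normal ∧ N.IsComplement' M := by
  obtain ⟨P, rfl⟩ := exists_sylow_coe_eq hM hn hp
  have hnorm := normalizer_eq_self_of_isCoatom hM hn
  constructor
  · have h1 := card_sylow_modEq_one p G
    have h2 := P.card_eq_index_normalizer
    rw [P.coe_coe] at hnorm
    rw [h2, hnorm] at h1
    exact h1
  -- The hypothesis of Burnside's transfer theorem: `M` is self-normalizing and abelian.
  · have hle : Subgroup.normalizer (P : Set G) ≤ Subgroup.centralizer (P : Set G) := by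
      rw [P.coe_coe] at hnorm hc
      rw [hnorm]; exact hc
    exact ⟨_, inferInstance, MonoidHom.ker_transferSylow_isComplement' P hle⟩

/-- A normal complement of a maximal subgroup is a minimal normal subgroup. -/
theorem eq_of_normal_of_le_complement [Finite G] {M N T : Subgroup G} (hM : IsCoatom M)
    (hNM : N.IsComplement' M) [T.Normal] (hT : T ≠ ⊥) (hTN : T ≤ N) : T = N := by
  have hsup : T ⊔ M = ⊤ := by
    refine (hM.le_iff.1 (le_sup_right : M ≤ T ⊔ M)).resolve_right fun h => hT ?_
    exact (hNM.disjoint hTN (h ▸ le_sup_left)) |> le_bot_iff.1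
  have h1 := Set.natCard_mul_le (s := (T : Set G)) (t := (M : Set G))
  rw [← Subgroup.normal_mul, hsup, Subgroup.coe_top, Nat.card_coe_set_eq, Set.ncard_univ,
    ← hNM.card_mul_card] at h1
  exact Subgroup.eq_of_le_of_card_ge hTN (Nat.le_of_mul_le_mul_right h1 Nat.card_pos)

/-- The Sylow 3-subgroup has index 2 in `N`, hence is characteristic there and normal in `G`,
against minimality of `N`. -/
theorem card_complement_ne_six [Finite G] {M N : Subgroup G} (hM : IsCoatom M) [N.Normal]
    (hNM : N.IsComplement' M) : Nat.card N ≠ 6 := by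
  intro h6
  have : Fact (Nat.Prime 3) := ⟨Nat.prime_three⟩
  obtain ⟨T⟩ := (inferInstance : Nonempty (Sylow 3 N))
  have hT3 : Nat.card T = 3 := by
    rw [T.card_eq_multiplicity, h6, Nat.factorization_def _ Nat.prime_three]
    have : padicValNat 3 6 = 1 := by
      rw [show 6 = 3 * 2 by norm_num, padicValNat.mul (by norm_num) (by norm_num), padicValNat_self,
        padicValNat.eq_zero_of_not_dvd (by norm_num)]
    rw [this, pow_one]
  have hTi : (T : Subgroup N).index = 2 := by
    have h1 := (T : Subgroup N).card_mul_index
    have h2 : Nat.card (T : Subgroup N) = 3 := hT3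
    rw [h6, h2] at h1
    omega
  have hTn : (T : Subgroup N).Normal := Subgroup.normal_of_index_eq_two hTi
  have hTc := T.characteristic_of_normal hTn
  have hcard : Nat.card ((T : Subgroup N).map N.subtype) = 3 := by
    rw [Subgroup.card_map_of_injective N.subtype_injective]; exact hT3
  have heq := eq_of_normal_of_le_complement hM hNM (T := (T : Subgroup N).map N.subtype)
    (fun h => by rw [h, Subgroup.card_bot] at hcard; omega) (Subgroup.map_subtype_le _)
  rw [heq] at hcard
  omega

/-- An order-2 subgroup `L` of `N` is not normal in `G`, and its number of conjugates divides the
odd `|M|`, so it is at least 3. With the 4 conjugates of `M` this gives 7 independent subgroups: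
mixed products have at most `2 * |M| < |G|` elements. -/
theorem card_complement_ne_four [Finite G] (hα : (comaximalGraph G).indepNum ≤ 6)
    {M N : Subgroup G} (hM : IsCoatom M) (hn : ¬ M.Normal) [N.Normal]
    (hNM : N.IsComplement' M) (hodd : Odd (Nat.card M)) : Nat.card N ≠ 4 := by
  intro h4
  have : Fact (Nat.Prime 2) := ⟨Nat.prime_two⟩
  obtain ⟨z, hz⟩ := exists_prime_orderOf_dvd_card' (G := N) 2 (by rw [h4]; norm_num)
  set L := Subgroup.zpowers (z : G) with hL
  have hLcard : Nat.card L = 2 := by rw [Nat.card_zpowers, Subgroup.orderOf_coe, hz]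
  have hLN : L ≤ N := Subgroup.zpowers_le.2 z.2
  have hLbot : L ≠ ⊥ := fun h => by rw [h, Subgroup.card_bot] at hLcard; omega
  have hG := hNM.card_mul_card
  rw [h4] at hG
  have hMi : M.index = 4 := by rw [hNM.index_eq_card, h4]
  have hM3 : 3 ≤ Nat.card M := by
    have h1 : Nat.card M ≠ 1 := fun h => hn (by
      rw [Subgroup.card_eq_one.1 h]; infer_instance)
    obtain ⟨c, hc⟩ := hodd
    omega
  have hLtop : L ≠ ⊤ := fun h => by rw [h, Subgroup.card_top] at hLcard; omega
  set B := Subgroup.normalizer (L : Set G) with hB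
  have hNB : N ≤ B := by
    rw [hB, ← Subgroup.normal_subgroupOf_iff_le_normalizer hLN]
    apply Subgroup.normal_of_index_eq_two
    have h1 := (L.subgroupOf N).card_mul_index
    rw [h4, Nat.card_congr (Subgroup.subgroupOfEquivOfLe hLN).toEquiv, hLcard] at h1
    omega
  have hBi : 3 ≤ B.index := by
    have h1 := Subgroup.index_dvd_of_le hNB
    rw [hNM.symm.index_eq_card] at h1
    have h2 : Odd B.index := Odd.of_dvd_nat hodd h1
    have h3 : B.index ≠ 1 := by
      intro h
      have : L.Normal := Subgroup.normalizer_eq_top_iff.1 (Subgroup.index_eq_one.1 h)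
      have := eq_of_normal_of_le_complement hM hNM hLbot hLN
      rw [this, h4] at hLcard
      omega
    obtain ⟨c, hc⟩ := h2
    omega
  have hMbot : M ≠ ⊥ := fun h => hn (h ▸ inferInstance)
  have hcc : ∀ (H : Subgroup G) (g : G), H ≠ ⊥ → H ≠ ⊤ → conjBy g H ≠ ⊥ ∧ conjBy g H ≠ ⊤ := by
    refine fun H g h1 h2 => ⟨conjBy_ne_bot h1 g, fun h => h2 ?_⟩
    rw [← conjBy_one H, ← inv_mul_cancel g, conjBy_mul, h, conjBy_of_normal]
  have := (ncard_le_indepNum ((Set.range fun g => conjBy g M) ∪ (Set.range fun g => conjBy g L))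
    (by
      rintro _ (⟨g, rfl⟩ | ⟨g, rfl⟩)
      · exact hcc M g hMbot hM.1
      · exact hcc L g hLbot hLtop)
    (by
      rintro _ (⟨a, rfl⟩ | ⟨a, rfl⟩) _ (⟨b, rfl⟩ | ⟨b, rfl⟩) -
      · exact conjBy_mul_conjBy_ne_univ hM.1 a b
      · apply mul_ne_univ_of_card_lt
        rw [card_conjBy, card_conjBy, hLcard]; omega
      · apply mul_ne_univ_of_card_lt
        rw [card_conjBy, card_conjBy, hLcard]; omega
      · exact conjBy_mul_conjBy_ne_univ hLtop a b)).trans hα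
  rw [Set.ncard_union_eq, ncard_range_conjBy_of_isCoatom hM hn, ncard_range_conjBy, hMi, ← hB] at this
  · omega
  · rw [Set.disjoint_left]
    rintro _ ⟨a, rfl⟩ ⟨b, hb⟩
    have h1 : Nat.card (conjBy b L) = Nat.card (conjBy a M) := congrArg (fun K : Subgroup G => Nat.card K) hb
    rw [card_conjBy, card_conjBy] at h1
    omega

/-- If conjugation by `x` has order dividing two on `⟨y⟩` of prime order, then `x` centralises or
inverts `y`. -/
theorem conj_eq_self_or_inv {x y : G} (hy : (orderOf y).Prime)
    (hxy : x * y * x⁻¹ ∈ Subgroup.zpowers y) (h2 : Commute (x ^ 2) y) :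
    x * y * x⁻¹ = y ∨ x * y * x⁻¹ = y⁻¹ := by
  obtain ⟨u, hu⟩ := Subgroup.mem_zpowers_iff.1 hxy
  have h3 : y ^ (u * u) = y := by
    rw [zpow_mul, hu, conj_zpow, hu]
    have h4 : x ^ 2 * y * (x ^ 2)⁻¹ = y := by rw [h2.eq, mul_inv_cancel_right]
    simpa only [pow_two, mul_inv_rev, mul_assoc] using h4
  -- Conjugation by `x` is the power map `u`, so `u ^ 2 = 1` modulo a prime and `u` is 1 or -1.
  have h4 : y ^ (u * u - 1) = 1 := by rw [zpow_sub, h3, zpow_one, mul_inv_cancel]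
  rw [← orderOf_dvd_iff_zpow_eq_one, show u * u - 1 = (u - 1) * (u + 1) by ring] at h4
  rcases (Nat.prime_iff_prime_int.1 hy).dvd_or_dvd h4 with h | h
  · left
    rw [orderOf_dvd_iff_zpow_eq_one, zpow_sub, zpow_one, mul_inv_eq_one] at h
    rw [← hu, h]
  · right
    rw [orderOf_dvd_iff_zpow_eq_one, zpow_add, zpow_one] at h
    rw [← hu, eq_inv_of_mul_eq_one_left h]

theorem exists_presentation [Finite G] {M N : Subgroup G} (hM : IsCoatom M) (hn : ¬ M.Normal)
    [hN : N.Normal] (hNM : N.IsComplement' M) (hq : (Nat.card N).Prime) {x : G}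
    (hx : Subgroup.zpowers x = M) (hx2 : x ^ 2 ∈ M.normalCore) :
    ∃ y : G, orderOf y = Nat.card N ∧ x * y * x⁻¹ = y⁻¹ ∧ Commute (x ^ 2) y := by
  have : Fact (Nat.card N).Prime := ⟨hq⟩
  obtain ⟨z, hz⟩ := exists_prime_orderOf_dvd_card' (G := N) (Nat.card N) dvd_rfl
  have hy : orderOf (z : G) = Nat.card N := by rw [Subgroup.orderOf_coe, hz]
  have hyN : Subgroup.zpowers (z : G) = N :=
    Subgroup.eq_of_le_of_card_ge (Subgroup.zpowers_le.2 z.2) (by rw [Nat.card_zpowers, hy])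
  -- The core of `M` and `N` are normal with trivial intersection, so they commute elementwise.
  have hcomm : Commute (x ^ 2) (z : G) :=
    Subgroup.commute_of_normal_of_disjoint M.normalCore N inferInstance hN
      (hNM.disjoint.symm.mono_left M.normalCore_le) _ _ hx2 z.2
  refine ⟨z, hy, ?_, hcomm⟩
  refine (conj_eq_self_or_inv (by rwa [hy]) (by rw [hyN]; exact hN.conj_mem _ z.2 x) hcomm).resolve_left fun h => ?_
  have hxz : Commute x (z : G) := mul_inv_eq_iff_eq_mul.1 h
  -- If `x` centralized `z`, then `z` would normalize the self-normalizing `M`.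
  have hzM : (z : G) ∈ M := by
    rw [← normalizer_eq_self_of_isCoatom hM hn]
    apply Subgroup.centralizer_le_normalizer
    rw [← hx, Subgroup.mem_centralizer_iff]
    rintro _ ⟨k, rfl⟩
    exact (hxz.zpow_left k).eq
  have hz1 : (z : G) = 1 := Subgroup.disjoint_def.1 hNM.disjoint z.2 hzM
  rw [hz1, orderOf_one] at hy
  exact hq.one_lt.ne hy

end Comaximal

/-! ### Assembling the classification. -/

open Comaximal in
theorem theorem4p1 (G : Type*) [Group G] [Finite G]
    (h : (comaximalGraph G).indepNum ≤ 6) :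
    Group.IsNilpotent G ∨
      Nonempty (G ≃* Equiv.Perm (Fin 3)) ∨
      Nonempty (G ≃* DihedralGroup 5) ∨
      Nonempty (G ≃* InvSemidirect 3 4 (by decide)) ∨
      Nonempty (G ≃* InvSemidirect 3 8 (by decide)) ∨
      Nonempty (G ≃* InvSemidirect 5 4 (by decide)) := by
  rw [or_iff_not_imp_left]
  intro hnil
  obtain ⟨M, hM, hn⟩ : ∃ M : Subgroup G, IsCoatom M ∧ ¬ M.Normal := by
    rw [Group.isNilpotent_of_finite_tfae.out 0 2 rfl rfl] at hnil
    push Not at hnil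
    exact hnil
  have hlt := fun H => le_normalCore_of_lt h hM hn (H := H)
  obtain ⟨x, hx, p, k, hp, hk, hcard⟩ := exists_generator_of_le_normalCore hn hlt
  have : Fact p.Prime := ⟨hp⟩
  have hcent : M ≤ Subgroup.centralizer (M : Set G) := by
    rw [← hx]
    rintro _ ⟨i, rfl⟩
    rw [Subgroup.mem_centralizer_iff]
    rintro _ ⟨j, rfl⟩
    exact ((Commute.refl x).zpow_zpow j i).eq
  obtain ⟨hmod, N, hN, hNM⟩ := exists_normal_isComplement' hM hn (IsPGroup.of_card hcard) hcent
  have hNi : M.index = Nat.card N := hNM.index_eq_card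
  rw [hNi] at hmod
  have h3 := three_le_index hn
  have h6 := (index_add_ncard_le hM hn ∅ (Set.empty_subset _) (by simp)).trans h
  rw [hNi] at h3 h6
  rw [Set.ncard_empty] at h6
  have hN6 := card_complement_ne_six hM hNM
  have hpd := (Nat.modEq_iff_dvd' (by omega)).1 hmod.symm
  have hN4 : Nat.card N ≠ 4 := by
    intro h4
    have hp3 : p = 3 := by
      rw [h4] at hpd
      exact (Nat.prime_dvd_prime_iff_eq hp Nat.prime_three).1 hpd
    refine card_complement_ne_four h hM hn hNM ?_ h4
    rw [hcard, hp3]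
    exact Odd.pow (by decide)
  have hN35 : Nat.card N = 3 ∨ Nat.card N = 5 := by omega
  have hp2 : p = 2 := by
    rcases hN35 with hc | hc <;> rw [hc] at hpd
    · exact (Nat.prime_dvd_prime_iff_eq hp Nat.prime_two).1 hpd
    · exact (Nat.prime_dvd_prime_iff_eq hp Nat.prime_two).1 (hp.dvd_of_dvd_pow
        (show p ∣ 2 ^ 2 from hpd))
  subst hp2
  have hox : orderOf x = 2 ^ k := by rw [← Nat.card_zpowers, hx, hcard]
  have hpow : ∀ j ≤ k, orderOf (x ^ 2 ^ j) = 2 ^ (k - j) := by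
    intro j hj
    rw [orderOf_pow, hox, Nat.gcd_eq_right (pow_dvd_pow 2 hj), Nat.pow_div hj two_pos]
  have hxM : x ∈ M := hx ▸ Subgroup.mem_zpowers x
  have hx2 : x ^ 2 ∈ M.normalCore := by
    have hle : Subgroup.zpowers (x ^ 2) ≤ M := Subgroup.zpowers_le.2 (M.pow_mem hxM 2)
    refine hlt _ (lt_of_le_of_ne hle fun he => ?_) (Subgroup.mem_zpowers _)
    have h1 := hpow 1 hk
    rw [pow_one, ← Nat.card_zpowers, he, hcard] at h1
    have := Nat.pow_right_injective le_rfl h1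
    omega
  have hq : (Nat.card N).Prime := by rcases hN35 with hc | hc <;> rw [hc] <;> norm_num
  obtain ⟨y, hy, hinv, hcomm⟩ := exists_presentation hM hn hNM hq hx hx2
  have hG : Nat.card G = Nat.card N * 2 ^ k := by rw [← hNM.card_mul_card, hcard]
  have hiso : ∀ n m : ℕ, ∀ hm : Even m, Nat.card N = n → 2 ^ k = m →
      Nonempty (G ≃* InvSemidirect n m hm) := by
    rintro n m hm hnN rfl
    rw [hnN] at hy hG hN35
    refine nonempty_mulEquiv_invSemidirect hm (by omega) (by positivity) ?_ hy hox hinv hG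
    exact Nat.Coprime.pow_right k (by rcases hN35 with hc | hc <;> rw [hc] <;> norm_num)
  rcases hN35 with hc | hc
  -- For `k ≥ 4` the proper cyclic subgroup generated by `y * x ^ 2` has order `3 * 2 ^ (k - 1)`, a
  -- multiple of 24; the seven proper divisors of 24 give seven independent subgroups.
  · have hk4 : k < 4 := by
      by_contra hk4
      obtain ⟨j, rfl⟩ := Nat.exists_eq_add_of_le (not_lt.1 hk4)
      have how : orderOf (y * x ^ 2) = 3 * 2 ^ (3 + j) := by
        have h1 := hpow 1 hk
        rw [pow_one, show 4 + j - 1 = 3 + j by omega] at h1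
        rw [hcomm.symm.orderOf_mul_eq_mul_orderOf_of_coprime, hy, hc, h1]
        rw [hy, hc, h1]
        exact Nat.Coprime.pow_right _ (by norm_num)
      have how' : orderOf (y * x ^ 2) = 24 * 2 ^ j := by rw [how, pow_add]; ring
      have hpos : 0 < 2 ^ j := by positivity
      have := (card_le_indepNum_of_zpowers_ne_top (w := y * x ^ 2) (fun ht => by
          have h1 := Nat.card_zpowers (y * x ^ 2)
          rw [ht, Subgroup.card_top, hG, hc, how', pow_add] at h1
          omega) {1, 2, 3, 4, 6, 8, 12} (by
          intro d hd
          have h1 : d ∣ 24 ∧ d < 24 := by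
            revert d; decide
          rw [how']
          exact ⟨h1.1.mul_right _, by omega⟩)).trans h
      exact absurd this (by decide)
    obtain rfl | rfl | rfl : k = 1 ∨ k = 2 ∨ k = 3 := by omega
    · obtain ⟨e⟩ := hiso 3 2 (by decide) hc rfl
      obtain ⟨f⟩ := nonempty_perm_three_mulEquiv
      exact Or.inl ⟨e.trans f.symm⟩
    · exact Or.inr (Or.inr (Or.inl (hiso 3 4 _ hc rfl)))
    · exact Or.inr (Or.inr (Or.inr (Or.inl (hiso 3 8 _ hc rfl))))
  -- For `k ≥ 3` the subgroups generated by `x ^ 2` and `x ^ 4` are nontrivial; with the five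
  -- conjugates of `M` they make seven.
  · have hk3 : k < 3 := by
      by_contra hk3
      have hz : ∀ j, 0 < j → j ≤ 2 → Subgroup.zpowers (x ^ 2 ^ j) ∈ conjFamily M ∧
          Nat.card (Subgroup.zpowers (x ^ 2 ^ j)) = 2 ^ (k - j) := by
        intro j hj0 hj
        have h1 : Nat.card (Subgroup.zpowers (x ^ 2 ^ j)) = 2 ^ (k - j) := by
          rw [Nat.card_zpowers, hpow j (by omega)]
        refine ⟨subset_conjFamily (fun hb => ?_)
          (Subgroup.zpowers_le.2 (M.pow_mem hxM _)), h1⟩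
        rw [hb, Subgroup.card_bot] at h1
        have := Nat.one_lt_two_pow (n := k - j) (by omega)
        omega
      have hlt' : ∀ i j, i < j → 2 ^ i < 2 ^ j := fun i j hij =>
        Nat.pow_lt_pow_right one_lt_two hij
      have := (index_add_ncard_le hM hn
        {Subgroup.zpowers (x ^ 2 ^ 1), Subgroup.zpowers (x ^ 2 ^ 2)} (by
          rintro _ (rfl | rfl)
          · exact (hz 1 (by omega) (by omega)).1
          · exact (hz 2 (by omega) (by omega)).1) (by
          rintro _ (rfl | rfl)
          · rw [(hz 1 (by omega) (by omega)).2, hcard]; exact hlt' _ _ (by omega)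
          · rw [(hz 2 (by omega) (by omega)).2, hcard]; exact hlt' _ _ (by omega))).trans h
      rw [Set.ncard_pair, hNi, hc] at this
      · omega
      · intro he
        have h1 := (hz 1 (by omega) (by omega)).2
        rw [he, (hz 2 (by omega) (by omega)).2] at h1
        exact absurd h1 (hlt' _ _ (by omega)).ne
    obtain rfl | rfl : k = 1 ∨ k = 2 := by omega
    · obtain ⟨e⟩ := hiso 5 2 (by decide) hc rfl
      obtain ⟨f⟩ := nonempty_dihedralGroup_mulEquiv (n := 5) (by decide)
      exact Or.inr (Or.inl ⟨e.trans f.symm⟩)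
    · exact Or.inr (Or.inr (Or.inr (Or.inr (hiso 5 4 _ hc rfl))))
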